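/- Let $\mathcal A$ be a set of atoms. Formulas are generated by $A,B ::= a \mid 1 \mid A\otimes B \mid A\multimap B \mid A\triangleleft B$ with $a\in\mathcal A$. Positions in a formula are positive or negative: the whole formula is positive, both arguments of $\otimes$ and $\triangleleft$ and the right argument of $\multimap$ keep the polarity, and the left argument of $\multimap$ reverses it. Inference rules are written "name: premise $\to$ conclusion"; a rule decorated $\circ$ may be applied in positive positions only, a rule decorated $\bullet$ in negative positions only, and an undecorated rule in both. The system $\mathsf{IBV}$ has the following rules, for all formulas $A,B,C,D$ and atoms $a$. * $\mathsf{ai}_\downarrow^\circ: 1\to a\multimap a$; $\ \mathsf u_\downarrow^{\triangleleft}$ (decorated $\circ$)$: A\to 1\triangleleft A$; $\ \mathsf u_\downarrow^{\triangleright}$ (decorated $\circ$)$: A\to A\triangleleft 1$; $\ \mathsf{ref}^\circ: A\otimes B\to A\triangleleft B$; $\ \mathsf{ref}^\bullet: A\triangleleft B\to A\otimes B$; * $\mathsf{s}_L^\circ: A\otimes(B\multimap C)\to(A\multimap B)\multimap C$; $\ \mathsf{s}_R^\circ: (A\multimap B)\otimes C\to A\multimap(B\otimes C)$; $\ \mathsf{s}_L^\bullet: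 (A\multimap B)\multimap C\to A\otimes(B\multimap C)$; $\ \mathsf{s}_R^\bullet: A\multimap(B\otimes C)\to(A\multimap B)\otimes C$; * $\mathsf{sq}_L^\circ: (A\multimap B)\triangleleft C\to A\multimap(B\triangleleft C)$; $\ \mathsf{sq}_R^\circ: B\triangleleft(A\multimap C)\to A\multimap(B\triangleleft C)$; $\ \mathsf{sq}_L^\bullet: (A\otimes B)\triangleleft C\to A\otimes(B\triangleleft C)$; $\ \mathsf{sq}_R^\bullet: B\triangleleft(A\otimes C)\to A\otimes(B\triangleleft C)$; * $\mathsf{q}_\downarrow^\circ: (A\multimap B)\triangleleft(C\multimap D)\to(A\triangleleft C)\multimap(B\triangleleft D)$; $\ \mathsf{q}_\downarrow^\bullet: (A\otimes B)\triangleleft(C\otimes D)\to(A\triangleleft C)\otimes(B\triangleleft D)$; * undecorated: $A\otimes B\to B\otimes A$; $\ (A\otimes B)\otimes C\to A\otimes(B\otimes C)$; $\ (A\triangleleft B)\triangleleft C\to A\triangleleft(B\triangleleft C)$; $\ A\triangleleft(B\triangleleft C)\to(A\triangleleft B)\triangleleft C$; $\ A\to 1\otimes A$; $\ A\to 1\multimap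 A$; $\ (A\otimes B)\multimap C\to A\multimap(B\multimap C)$; $\ A\multimap(B\multimap C)\to(A\otimes B)\multimap C$. The system $\mathsf{SIBV}$ consists of $\mathsf{IBV}$ together with the up-rules $\mathsf{ai}_\uparrow^\bullet: a\multimap a\to 1$; $\ \mathsf u_\uparrow^{\triangleleft}$ (decorated $\bullet$)$: 1\triangleleft A\to A$; $\ \mathsf u_\uparrow^{\triangleright}$ (decorated $\bullet$)$: A\triangleleft 1\to A$; $\ \mathsf u_\uparrow^{\otimes}$ (undecorated)$: 1\otimes A\to A$; $\ \mathsf u_\uparrow^{\multimap}$ (undecorated)$: 1\multimap A\to A$; $\ \mathsf q_\uparrow^\circ: (A\triangleleft C)\otimes(B\triangleleft D)\to(A\otimes B)\triangleleft(C\otimes D)$; $\ \mathsf q_\uparrow^\bullet: (A\triangleleft C)\multimap(B\triangleleft D)\to(A\multimap B)\triangleleft(C\multimap D)$. The (general) cut rule is $\mathsf i_\uparrow^\bullet: A\multimap A\to 1$ for an arbitrary formula $A$. For a set $\mathsf X$ of rules, positive and negative derivations in $\mathsf X$, each with a premise and a conclusion, are defined inductively: every formula is a derivation, of either polarity, from itself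 to itself; derivations $A\to A'$ and $B\to B'$ of the same polarity give derivations $A\otimes B\to A'\otimes B'$ and $A\triangleleft B\to A'\triangleleft B'$ of that polarity; a derivation $A\to A'$ of the opposite polarity and a derivation $B\to B'$ of polarity $p$ give a derivation $A\multimap B\to A'\multimap B'$ of polarity $p$; and derivations $A\to B$ and $C\to D$ of polarity $p$ together with an instance with premise $B$ and conclusion $C$ of a rule of $\mathsf X$ that is allowed in positions of polarity $p$ give a derivation $A\to D$ of polarity $p$. We write $\vdash_{\mathsf X}A$ if there is a positive derivation in $\mathsf X$ with premise $1$ and conclusion $A$. A rule $\mathsf r$ is admissible for $\mathsf X$ if $\vdash_{\mathsf X\cup\{\mathsf r\}}A$ implies $\vdash_{\mathsf X}A$ for every formula $A$. **Theorem.** 1. Each of the rules $\mathsf u_\uparrow^{\triangleleft}$, $\mathsf u_\uparrow^{\triangleright}$, $\mathsf u_\uparrow^{\otimes}$, $\mathsf u_\uparrow^{\multimap}$, $\mathsf{ai}_\uparrow^\bullet$, $\mathsf q_\uparrow^\circ$ and $\mathsf q_\uparrow^\bullet$ is admissible for $\mathsf{IBV}$. 2. For every formula $A$: $\vdash_{\mathsf{SIBV}}A$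 if and only if $\vdash_{\mathsf{IBV}}A$. 3. The cut rule $\mathsf i_\uparrow^\bullet$ is admissible for $\mathsf{IBV}$. -/

import Mathlib

namespace IBVLogic

/-- Formulas over a set `α` of atoms: `A, B ::= a | 1 | A ⊗ B | A ⊸ B | A ◁ B`. -/
inductive Formula (α : Type*) where
  | atom (a : α) : Formula α
  | unit : Formula α
  | tens (A B : Formula α) : Formula α
  | imp (A B : Formula α) : Formula α
  | seq (A B : Formula α) : Formula α

/-- Polarity of a position in a formula, and of a derivation. -/
inductive Polarity where
  | pos
  | neg

/-- The opposite polarity. -/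
def Polarity.flip : Polarity → Polarity
  | .pos => .neg
  | .neg => .pos

/-- The names of all inference rules. A final `P` stands for the decoration `∘` (the rule applies
in positive positions only), a final `N` for `•` (negative positions only). -/
inductive Rule where
  -- down-rules and polarised rules
  | aiDownP | uDownSeqLeftP | uDownSeqRightP | refP | refN
  | sLP | sRP | sLN | sRN
  | sqLP | sqRP | sqLN | sqRN
  | qDownP | qDownN
  -- undecorated rules
  | comTens | assoTens | assoSeqL | assoSeqR | uDownTens | uDownImp | cur | ruc
  -- up-rules
  | aiUpN | uUpSeqLeftN | uUpSeqRightN | uUpTens | uUpImp | qUpP | qUpN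
  -- general identity and cut
  | iDownP | iUpN

/-- `r.Inst p A B`: in positions of polarity `p`, the rule `r` has an instance with premise `A`
and conclusion `B`. -/
inductive Rule.Inst {α : Type*} : Rule → Polarity → Formula α → Formula α → Prop where
  | aiDownP (a : α) : Inst .aiDownP .pos .unit (.imp (.atom a) (.atom a))
  | uDownSeqLeftP (A : Formula α) : Inst .uDownSeqLeftP .pos A (.seq .unit A)
  | uDownSeqRightP (A : Formula α) : Inst .uDownSeqRightP .pos A (.seq A .unit)
  | refP (A B : Formula α) : Inst .refP .pos (.tens A B) (.seq A B)
  | refN (A B : Formula α) : Inst .refN .neg (.seq A B) (.tens A B)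
  | sLP (A B C : Formula α) : Inst .sLP .pos (.tens A (.imp B C)) (.imp (.imp A B) C)
  | sRP (A B C : Formula α) : Inst .sRP .pos (.tens (.imp A B) C) (.imp A (.tens B C))
  | sLN (A B C : Formula α) : Inst .sLN .neg (.imp (.imp A B) C) (.tens A (.imp B C))
  | sRN (A B C : Formula α) : Inst .sRN .neg (.imp A (.tens B C)) (.tens (.imp A B) C)
  | sqLP (A B C : Formula α) : Inst .sqLP .pos (.seq (.imp A B) C) (.imp A (.seq B C))
  | sqRP (A B C : Formula α) : Inst .sqRP .pos (.seq B (.imp A C)) (.imp A (.seq B C))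
  | sqLN (A B C : Formula α) : Inst .sqLN .neg (.seq (.tens A B) C) (.tens A (.seq B C))
  | sqRN (A B C : Formula α) : Inst .sqRN .neg (.seq B (.tens A C)) (.tens A (.seq B C))
  | qDownP (A B C D : Formula α) :
      Inst .qDownP .pos (.seq (.imp A B) (.imp C D)) (.imp (.seq A C) (.seq B D))
  | qDownN (A B C D : Formula α) :
      Inst .qDownN .neg (.seq (.tens A B) (.tens C D)) (.tens (.seq A C) (.seq B D))
  | comTens (p : Polarity) (A B : Formula α) : Inst .comTens p (.tens A B) (.tens B A)
  | assoTens (p : Polarity) (A B C : Formula α) :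
      Inst .assoTens p (.tens (.tens A B) C) (.tens A (.tens B C))
  | assoSeqL (p : Polarity) (A B C : Formula α) :
      Inst .assoSeqL p (.seq (.seq A B) C) (.seq A (.seq B C))
  | assoSeqR (p : Polarity) (A B C : Formula α) :
      Inst .assoSeqR p (.seq A (.seq B C)) (.seq (.seq A B) C)
  | uDownTens (p : Polarity) (A : Formula α) : Inst .uDownTens p A (.tens .unit A)
  | uDownImp (p : Polarity) (A : Formula α) : Inst .uDownImp p A (.imp .unit A)
  | cur (p : Polarity) (A B C : Formula α) :
      Inst .cur p (.imp (.tens A B) C) (.imp A (.imp B C))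
  | ruc (p : Polarity) (A B C : Formula α) :
      Inst .ruc p (.imp A (.imp B C)) (.imp (.tens A B) C)
  | aiUpN (a : α) : Inst .aiUpN .neg (.imp (.atom a) (.atom a)) .unit
  | uUpSeqLeftN (A : Formula α) : Inst .uUpSeqLeftN .neg (.seq .unit A) A
  | uUpSeqRightN (A : Formula α) : Inst .uUpSeqRightN .neg (.seq A .unit) A
  | uUpTens (p : Polarity) (A : Formula α) : Inst .uUpTens p (.tens .unit A) A
  | uUpImp (p : Polarity) (A : Formula α) : Inst .uUpImp p (.imp .unit A) A
  | qUpP (A B C D : Formula α) :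
      Inst .qUpP .pos (.tens (.seq A C) (.seq B D)) (.seq (.tens A B) (.tens C D))
  | qUpN (A B C D : Formula α) :
      Inst .qUpN .neg (.imp (.seq A C) (.seq B D)) (.seq (.imp A B) (.imp C D))
  | iDownP (A : Formula α) : Inst .iDownP .pos .unit (.imp A A)
  | iUpN (A : Formula α) : Inst .iUpN .neg (.imp A A) .unit

/-- The system `IBV`. -/
def IBV : Set Rule :=
  {.aiDownP, .uDownSeqLeftP, .uDownSeqRightP, .refP, .refN,
    .sLP, .sRP, .sLN, .sRN, .sqLP, .sqRP, .sqLN, .sqRN, .qDownP, .qDownN,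
    .comTens, .assoTens, .assoSeqL, .assoSeqR, .uDownTens, .uDownImp, .cur, .ruc}

/-- The up-rules added to `IBV` in the symmetric system. -/
def upRules : Set Rule :=
  {.aiUpN, .uUpSeqLeftN, .uUpSeqRightN, .uUpTens, .uUpImp, .qUpP, .qUpN}

/-- The system `SIBV`. -/
def SIBV : Set Rule := IBV ∪ upRules

/-- `Derivation X p A B`: there is an open-deduction derivation of polarity `p` with premise `A`
and conclusion `B` all of whose inference rules are in `X`. Derivations are built from identity
derivations, horizontally by the connectives (the left of `⊸` has the opposite polarity), and
vertically by a rule instance of the same polarity. -/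
inductive Derivation {α : Type*} (X : Set Rule) : Polarity → Formula α → Formula α → Prop where
  | id (p : Polarity) (A : Formula α) : Derivation X p A A
  | tens {p : Polarity} {A A' B B' : Formula α} :
      Derivation X p A A' → Derivation X p B B' → Derivation X p (.tens A B) (.tens A' B')
  | seq {p : Polarity} {A A' B B' : Formula α} :
      Derivation X p A A' → Derivation X p B B' → Derivation X p (.seq A B) (.seq A' B')
  | imp {p : Polarity} {A A' B B' : Formula α} :
      Derivation X p.flip A A' → Derivation X p B B' → Derivation X p (.imp A B) (.imp A' B')
  | comp {p : Polarity} {r : Rule} {A B C D : Formula α} :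
      Derivation X p A B → r ∈ X → r.Inst p B C → Derivation X p C D → Derivation X p A D

/-- `A` has a proof in `X`: a positive derivation with premise `1` and conclusion `A`. -/
def Provable {α : Type*} (X : Set Rule) (A : Formula α) : Prop :=
  Derivation X .pos .unit A

/-- The rule `r` is admissible for the system `X` (over atoms from `α`): adding `r` to `X` yields
no new provable formulas. -/
def Admissible (α : Type*) (X : Set Rule) (r : Rule) : Prop :=
  ∀ A : Formula α, Provable (X ∪ {r}) A → Provable X A

end IBVLogic

namespace IBVLogic

/-! This is semantic cut elimination in a phase model built from `IBV` itself. Contexts are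
preordered by negative `IBV` derivations; propositions are sets of contexts closed along this
preorder, ordered by inclusion. The connectives ⊗ and ◁ act elementwise followed by closure, and ⊸
is the residual of ⊗.

Every rule is valid in this model (`Derivation.sound`). Negative positions reverse the order, so cut
becomes the same inequality 1 ≤ P ⊸ P as identity. Conversely, by a simultaneous induction in the
style of Okada (`Formula.mem_interp_and_proves`), A lies in its own interpretation and every context
there proves A in `IBV`. If A is provable with any of the rules, the empty context therefore lies in
its interpretation, so `IBV` proves A.

The empty context is adjoined as a strict unit because the formula 1 cannot play that role: `IBV`
has no rule that erases units. -/

variable {α : Type*}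

local infixr:70 " ⊗ᶠ " => Formula.tens
local infixr:65 " ◁ᶠ " => Formula.seq
local infixr:60 " ⊸ᶠ " => Formula.imp

/-! ### Derivations -/

namespace Derivation

variable {X : Set Rule} {p : Polarity} {A B C D : Formula α}

/-- Since `comp` glues only through a rule instance, two horizontal compositions must be merged
argument by argument. The inner inductions peel off any `comp` in the second derivation. -/
theorem trans (h₁ : Derivation X p A B) (h₂ : Derivation X p B C) : Derivation X p A C := by
  induction h₁ generalizing C with
  | id => exact h₂
  | comp d hr hi _ _ ih => exact .comp d hr hi (ih h₂)
  | @tens p A A' B B' a b iha ihb =>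
    generalize hE : A' ⊗ᶠ B' = E at h₂
    induction h₂ with
    | id => subst hE; exact .tens a b
    | tens c d =>
      obtain ⟨rfl, rfl⟩ := Formula.tens.inj hE
      exact .tens (iha c) (ihb d)
    | seq => cases hE
    | imp => cases hE
    | comp _ hr hi f ih => exact .comp (ih a b iha ihb hE) hr hi f
  | @seq p A A' B B' a b iha ihb =>
    generalize hE : A' ◁ᶠ B' = E at h₂
    induction h₂ with
    | id => subst hE; exact .seq a b
    | seq c d =>
      obtain ⟨rfl, rfl⟩ := Formula.seq.inj hE
      exact .seq (iha c) (ihb d)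
    | tens => cases hE
    | imp => cases hE
    | comp _ hr hi f ih => exact .comp (ih a b iha ihb hE) hr hi f
  | @imp p A A' B B' a b iha ihb =>
    generalize hE : A' ⊸ᶠ B' = E at h₂
    induction h₂ with
    | id => subst hE; exact .imp a b
    | imp c d =>
      obtain ⟨rfl, rfl⟩ := Formula.imp.inj hE
      exact .imp (iha c) (ihb d)
    | tens => cases hE
    | seq => cases hE
    | comp _ hr hi f ih => exact .comp (ih a b iha ihb hE) hr hi f

theorem of_inst {r : Rule} (hr : r ∈ X) (hi : r.Inst p A B) : Derivation X p A B :=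
  .comp (.id _ _) hr hi (.id _ _)

theorem tens_comm : Derivation IBV p (A ⊗ᶠ B) (B ⊗ᶠ A) :=
  of_inst (by simp [IBV]) (.comTens p A B)

theorem tens_assoc : Derivation IBV p ((A ⊗ᶠ B) ⊗ᶠ C) (A ⊗ᶠ B ⊗ᶠ C) :=
  of_inst (by simp [IBV]) (.assoTens p A B C)

theorem seq_assoc : Derivation IBV p ((A ◁ᶠ B) ◁ᶠ C) (A ◁ᶠ B ◁ᶠ C) :=
  of_inst (by simp [IBV]) (.assoSeqL p A B C)

theorem seq_assoc_symm : Derivation IBV p (A ◁ᶠ B ◁ᶠ C) ((A ◁ᶠ B) ◁ᶠ C) :=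
  of_inst (by simp [IBV]) (.assoSeqR p A B C)

theorem unit_tens : Derivation IBV p A (.unit ⊗ᶠ A) :=
  of_inst (by simp [IBV]) (.uDownTens p A)

theorem unit_imp : Derivation IBV p A (.unit ⊸ᶠ A) :=
  of_inst (by simp [IBV]) (.uDownImp p A)

end Derivation

/-- `X` is turned into `Y` by a negative derivation in `IBV`. -/
abbrev NegDerivation (X Y : Formula α) : Prop := Derivation IBV .neg X Y

/-! ### Negative derivations between hypotheses -/

namespace NegDerivation

variable {A B C D : Formula α}

theorem refl (A : Formula α) : NegDerivation A A := .id _ _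

theorem seq_tens : NegDerivation (A ◁ᶠ B) (A ⊗ᶠ B) :=
  .of_inst (by simp [IBV]) (.refN A B)

theorem tens_seq : NegDerivation (A ⊗ᶠ B ◁ᶠ C) (A ⊗ᶠ (B ◁ᶠ C)) :=
  .of_inst (by simp [IBV]) (.sqLN A B C)

theorem seq_tens_right : NegDerivation (B ◁ᶠ A ⊗ᶠ C) (A ⊗ᶠ (B ◁ᶠ C)) :=
  .of_inst (by simp [IBV]) (.sqRN A B C)

theorem exchange : NegDerivation (A ⊗ᶠ B ◁ᶠ C ⊗ᶠ D) ((A ◁ᶠ C) ⊗ᶠ (B ◁ᶠ D)) :=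
  .of_inst (by simp [IBV]) (.qDownN A B C D)

/-- The left of ⊸ in a negative derivation is positive, so a unit introduced there can be expanded
into a proof of A. -/
theorem unit_of_provable (h : Provable IBV A) : NegDerivation B (A ⊸ᶠ B) :=
  Derivation.unit_imp.trans (.imp h (refl B))

/-- The negative rule s_L splits (C ⊸ A) ⊸ B. This internal modus ponens is what later puts A ⊸ B
into its own interpretation. -/
theorem imp_tens (h : Provable IBV (C ⊸ᶠ A)) : NegDerivation B ((A ⊸ᶠ B) ⊗ᶠ C) :=
  (unit_of_provable h).trans
    (.trans (.of_inst (by simp [IBV]) (.sLN C A B)) Derivation.tens_comm)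

end NegDerivation

/-! ### Rules for provability in `IBV` -/

namespace Provable

variable {A B C D : Formula α}

theorem mono (h : Provable IBV A) (d : Derivation IBV .pos A B) : Provable IBV B :=
  Derivation.trans h d

theorem tens (h₁ : Provable IBV A) (h₂ : Provable IBV B) : Provable IBV (A ⊗ᶠ B) :=
  Derivation.unit_tens.trans (.tens h₁ h₂)

theorem seq (h₁ : Provable IBV A) (h₂ : Provable IBV B) : Provable IBV (A ◁ᶠ B) :=
  (h₁.tens h₂).mono (.of_inst (by simp [IBV]) (.refP A B))

theorem tens_imp_left (h : Provable IBV ((A ⊸ᶠ B) ⊗ᶠ C)) : Provable IBV (A ⊸ᶠ B ⊗ᶠ C) :=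
  h.mono (.of_inst (by simp [IBV]) (.sRP A B C))

theorem imp_tens_comm (h : Provable IBV (A ⊸ᶠ B ⊗ᶠ C)) : Provable IBV (A ⊸ᶠ C ⊗ᶠ B) :=
  h.mono (.imp (.id _ _) Derivation.tens_comm)

theorem curry (h : Provable IBV (A ⊗ᶠ B ⊸ᶠ C)) : Provable IBV (A ⊸ᶠ B ⊸ᶠ C) :=
  h.mono (.of_inst (by simp [IBV]) (.cur .pos A B C))

theorem uncurry (h : Provable IBV (A ⊸ᶠ B ⊸ᶠ C)) : Provable IBV (A ⊗ᶠ B ⊸ᶠ C) :=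
  h.mono (.of_inst (by simp [IBV]) (.ruc .pos A B C))

theorem imp_tens_imp (h₁ : Provable IBV (A ⊸ᶠ B)) (h₂ : Provable IBV (C ⊸ᶠ D)) :
    Provable IBV (A ⊗ᶠ C ⊸ᶠ B ⊗ᶠ D) :=
  have h : Provable IBV (A ⊸ᶠ (C ⊸ᶠ D) ⊗ᶠ B) := (h₁.tens h₂).tens_imp_left.imp_tens_comm
  (h.mono (.imp (.id _ _) (.of_inst (by simp [IBV]) (.sRP C D B)))).uncurry.imp_tens_comm

theorem imp_seq_imp (h₁ : Provable IBV (A ⊸ᶠ B)) (h₂ : Provable IBV (C ⊸ᶠ D)) :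
    Provable IBV (A ◁ᶠ C ⊸ᶠ B ◁ᶠ D) :=
  (h₁.seq h₂).mono (.of_inst (by simp [IBV]) (.qDownP A B C D))

theorem imp_seq (h₁ : Provable IBV (A ⊸ᶠ B)) (h₂ : Provable IBV C) :
    Provable IBV (A ⊸ᶠ B ◁ᶠ C) :=
  (h₁.seq h₂).mono (.of_inst (by simp [IBV]) (.sqLP A B C))

theorem seq_imp (h₁ : Provable IBV B) (h₂ : Provable IBV (A ⊸ᶠ C)) :
    Provable IBV (A ⊸ᶠ B ◁ᶠ C) :=
  (h₁.seq h₂).mono (.of_inst (by simp [IBV]) (.sqRP A B C))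

end Provable

/-! ### Contexts -/

/-- A context is a formula used as hypothesis, or the empty context `none`. -/
abbrev Context (α : Type*) := Option (Formula α)

namespace Context

/-- The tensor of contexts, with the empty context as strict unit. -/
def tens : Context α → Context α → Context α
  | none, Y => Y
  | some X, none => some X
  | some X, some Y => some (X ⊗ᶠ Y)

/-- The sequential composition of contexts, with the empty context as strict unit. -/
def seq : Context α → Context α → Context α
  | none, Y => Y
  | some X, none => some X
  | some X, some Y => some (X ◁ᶠ Y)

/-- Strengthening of contexts by negative derivations in `IBV`. -/
def Red : Context α → Context α → Prop
  | none, none => True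
  | none, some Y => NegDerivation .unit Y
  | some _, none => False
  | some X, some Y => NegDerivation X Y

/-- `Γ.Proves A` states that `A` is provable in `IBV` under the hypothesis `Γ`. -/
def Proves : Context α → Formula α → Prop
  | none, A => Provable IBV A
  | some X, A => Provable IBV (X ⊸ᶠ A)

variable {Γ Δ Θ Γ' Δ' : Context α} {A B : Formula α}

@[simp] theorem tens_none : tens Γ none = Γ := by cases Γ <;> rfl
@[simp] theorem seq_none : seq Γ none = Γ := by cases Γ <;> rfl

theorem Red.refl (Γ : Context α) : Red Γ Γ := by
  cases Γ
  · trivial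
  · exact NegDerivation.refl _

theorem Red.trans (h₁ : Red Γ Δ) (h₂ : Red Δ Θ) : Red Γ Θ := by
  rcases Γ with _ | X <;> rcases Δ with _ | Y <;> rcases Θ with _ | Z <;>
    first
      | exact h₁.elim
      | exact h₂.elim
      | exact h₂
      | exact Derivation.trans h₁ h₂

theorem red_tens_comm (Γ Δ : Context α) : Red (tens Γ Δ) (tens Δ Γ) := by
  rcases Γ with _ | X <;> rcases Δ with _ | Y <;>
    first
      | exact Red.refl _
      | exact Derivation.tens_comm

theorem red_tens_assoc (Γ Δ Θ : Context α) :
    Red (tens (tens Γ Δ) Θ) (tens Γ (tens Δ Θ)) := by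
  rcases Γ with _ | X <;> rcases Δ with _ | Y <;> rcases Θ with _ | Z <;>
    first
      | exact Red.refl _
      | exact Derivation.tens_assoc

theorem red_seq_assoc (Γ Δ Θ : Context α) :
    Red (seq (seq Γ Δ) Θ) (seq Γ (seq Δ Θ)) := by
  rcases Γ with _ | X <;> rcases Δ with _ | Y <;> rcases Θ with _ | Z <;>
    first
      | exact Red.refl _
      | exact Derivation.seq_assoc

theorem red_seq_assoc_symm (Γ Δ Θ : Context α) :
    Red (seq Γ (seq Δ Θ)) (seq (seq Γ Δ) Θ) := by
  rcases Γ with _ | X <;> rcases Δ with _ | Y <;> rcases Θ with _ | Z <;>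
    first
      | exact Red.refl _
      | exact Derivation.seq_assoc_symm

/-- When Γ is empty and Γ' is not, a unit must be inserted beside Δ; this works because A → 1 ⊗ A is
undecorated. The corresponding rules for ◁ are positive only. -/
theorem Red.tens_right (h : Red Γ Γ') (Δ : Context α) : Red (tens Γ Δ) (tens Γ' Δ) := by
  rcases Δ with _ | Y
  · simpa using h
  · rcases Γ with _ | X <;> rcases Γ' with _ | X'
    · exact Red.refl _
    · exact Derivation.unit_tens.trans (.tens h (.id _ _))
    · exact h.elim
    · exact Derivation.tens h (.id _ _)

theorem Red.tens (h₁ : Red Γ Γ') (h₂ : Red Δ Δ') : Red (tens Γ Δ) (tens Γ' Δ') :=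
  (h₁.tens_right Δ).trans <| (red_tens_comm _ _).trans <|
    (h₂.tens_right Γ').trans (red_tens_comm _ _)

/-- With components missing, negative q↓ degenerates, up to commutativity of ⊗, to negative ref,
sq_L, sq_R or an identity. This is the role of those rules in `IBV`. -/
theorem red_exchange (Γ Γ' Δ Δ' : Context α) :
    Red (seq (tens Γ Γ') (tens Δ Δ')) (tens (seq Γ Δ) (seq Γ' Δ')) := by
  rcases Γ with _ | A <;> rcases Γ' with _ | B <;> rcases Δ with _ | C <;> rcases Δ' with _ | D <;>
    first
      | exact Red.refl _
      | exact NegDerivation.exchange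
      | exact NegDerivation.seq_tens
      | exact NegDerivation.tens_seq
      | exact NegDerivation.seq_tens_right
      | exact NegDerivation.seq_tens.trans Derivation.tens_comm
      | exact (Derivation.seq Derivation.tens_comm (.id _ _)).trans
          (NegDerivation.tens_seq.trans Derivation.tens_comm)
      | exact (Derivation.seq (.id _ _) Derivation.tens_comm).trans
          (NegDerivation.seq_tens_right.trans Derivation.tens_comm)

theorem Proves.red (h : Γ.Proves A) (hr : Red Γ Δ) : Δ.Proves A := by
  rcases Γ with _ | X <;> rcases Δ with _ | Y
  · exact h
  · exact Provable.mono h (Derivation.unit_imp.trans (.imp hr (.id _ _)))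
  · exact hr.elim
  · exact Provable.mono h (.imp hr (.id _ _))

theorem Proves.tens (h₁ : Γ.Proves A) (h₂ : Δ.Proves B) : (tens Γ Δ).Proves (A ⊗ᶠ B) := by
  rcases Γ with _ | X <;> rcases Δ with _ | Y
  · exact Provable.tens h₁ h₂
  · exact (Provable.tens h₂ h₁).tens_imp_left.imp_tens_comm
  · exact (Provable.tens h₁ h₂).tens_imp_left
  · exact Provable.imp_tens_imp h₁ h₂

theorem Proves.seq (h₁ : Γ.Proves A) (h₂ : Δ.Proves B) : (seq Γ Δ).Proves (A ◁ᶠ B) := by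
  rcases Γ with _ | X <;> rcases Δ with _ | Y
  · exact Provable.seq h₁ h₂
  · exact Provable.seq_imp h₁ h₂
  · exact Provable.imp_seq h₁ h₂
  · exact Provable.imp_seq_imp h₁ h₂

theorem Proves.curry (h : (Context.tens Γ (some A)).Proves B) : Γ.Proves (A ⊸ᶠ B) := by
  rcases Γ with _ | X
  · exact h
  · exact Provable.curry h

theorem Proves.red_tens_imp (h : Γ.Proves A) :
    Red (some B) (Context.tens (some (A ⊸ᶠ B)) Γ) := by
  rcases Γ with _ | X
  · exact NegDerivation.unit_of_provable h
  · exact NegDerivation.imp_tens h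

end Context

/-! ### The phase model -/

open Context

/-- The propositions of the phase model: sets of contexts closed under strengthening. -/
structure Prp (α : Type*) where
  /-- The contexts that force the proposition. -/
  carrier : Set (Context α)
  red_mem {Γ Δ : Context α} : Γ ∈ carrier → Red Γ Δ → Δ ∈ carrier

namespace Prp

variable {P Q R S P' Q' : Prp α}

instance : Membership (Context α) (Prp α) := ⟨fun P Γ => Γ ∈ P.carrier⟩

instance : Preorder (Prp α) := Preorder.lift carrier

theorem mem_of_red {Γ Δ : Context α} (h : Γ ∈ P) (hr : Red Γ Δ) : Δ ∈ P := P.red_mem h hr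

/-- The unit proposition. -/
def unit : Prp α := ⟨{Γ | Red none Γ}, fun h hr => Red.trans h hr⟩

/-- The proposition forced by the contexts that prove a given formula. -/
def provers (A : Formula α) : Prp α := ⟨{Γ | Γ.Proves A}, fun h hr => h.red hr⟩

/-- The tensor of propositions. -/
def tens (P Q : Prp α) : Prp α :=
  ⟨{Θ | ∃ Γ ∈ P, ∃ Δ ∈ Q, Red (Γ.tens Δ) Θ},
    fun ⟨Γ, hΓ, Δ, hΔ, h⟩ hr => ⟨Γ, hΓ, Δ, hΔ, h.trans hr⟩⟩

/-- The sequential composition of propositions. -/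
def seq (P Q : Prp α) : Prp α :=
  ⟨{Θ | ∃ Γ ∈ P, ∃ Δ ∈ Q, Red (Γ.seq Δ) Θ},
    fun ⟨Γ, hΓ, Δ, hΔ, h⟩ hr => ⟨Γ, hΓ, Δ, hΔ, h.trans hr⟩⟩

/-- The residual of the tensor. -/
def imp (P Q : Prp α) : Prp α :=
  ⟨{Γ | ∀ Δ ∈ P, Γ.tens Δ ∈ Q}, fun h hr Δ hΔ => Q.red_mem (h Δ hΔ) (hr.tens_right Δ)⟩

theorem tens_mono (h₁ : P ≤ P') (h₂ : Q ≤ Q') : P.tens Q ≤ P'.tens Q' :=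
  fun _ ⟨Γ, hΓ, Δ, hΔ, h⟩ => ⟨Γ, h₁ hΓ, Δ, h₂ hΔ, h⟩

theorem seq_mono (h₁ : P ≤ P') (h₂ : Q ≤ Q') : P.seq Q ≤ P'.seq Q' :=
  fun _ ⟨Γ, hΓ, Δ, hΔ, h⟩ => ⟨Γ, h₁ hΓ, Δ, h₂ hΔ, h⟩

theorem tens_le_iff : P.tens Q ≤ R ↔ P ≤ Q.imp R :=
  ⟨fun h Γ hΓ Δ hΔ => h ⟨Γ, hΓ, Δ, hΔ, Red.refl _⟩,
    fun h _ ⟨_, hΓ, Δ, hΔ, hr⟩ => R.red_mem (h hΓ Δ hΔ) hr⟩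

theorem imp_tens_le : (P.imp Q).tens P ≤ Q := tens_le_iff.2 le_rfl

theorem imp_mono (h₁ : P' ≤ P) (h₂ : Q ≤ Q') : P.imp Q ≤ P'.imp Q' :=
  tens_le_iff.1 <| (tens_mono le_rfl h₁).trans (imp_tens_le.trans h₂)

theorem tens_comm : P.tens Q ≤ Q.tens P :=
  fun _ ⟨Γ, hΓ, Δ, hΔ, h⟩ => ⟨Δ, hΔ, Γ, hΓ, (red_tens_comm _ _).trans h⟩

theorem tens_assoc_symm : P.tens (Q.tens R) ≤ (P.tens Q).tens R :=
  fun _ ⟨Γ, hΓ, _, ⟨Δ, hΔ, Θ, hΘ, h₁⟩, h₂⟩ =>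
    ⟨Γ.tens Δ, ⟨Γ, hΓ, Δ, hΔ, Red.refl _⟩, Θ, hΘ,
      (red_tens_assoc Γ Δ Θ).trans (((Red.refl Γ).tens h₁).trans h₂)⟩

theorem tens_assoc : (P.tens Q).tens R ≤ P.tens (Q.tens R) :=
  tens_comm.trans <| (tens_mono le_rfl tens_comm).trans <| tens_assoc_symm.trans <|
    tens_comm.trans (tens_mono le_rfl tens_comm)

theorem none_mem_unit : none ∈ (unit : Prp α) := Red.refl (none : Context α)

theorem le_unit_tens : P ≤ unit.tens P := fun Γ h => ⟨none, none_mem_unit, Γ, h, Red.refl _⟩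

theorem unit_tens_le : unit.tens P ≤ P := fun _ ⟨_, hΓ, Δ, hΔ, h⟩ =>
  P.red_mem hΔ (.trans (Red.tens_right hΓ Δ) h)

theorem le_unit_seq : P ≤ unit.seq P := fun Γ h => ⟨none, none_mem_unit, Γ, h, Red.refl _⟩

theorem le_seq_unit : P ≤ P.seq unit := fun Γ h => ⟨Γ, h, none, none_mem_unit, by simp [Red.refl]⟩

theorem seq_assoc : (P.seq Q).seq R ≤ P.seq (Q.seq R) := by
  rintro Λ ⟨Ψ, ⟨Γ, hΓ, Δ, hΔ, h₁⟩, Θ, hΘ, h₂⟩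
  -- Under ◁, a reduction from the empty context to a nonempty one cannot be used congruently. If Γ
  -- is empty, `h₁` already puts Ψ in Q; otherwise Ψ is nonempty and no such reduction occurs.
  rcases Γ with _ | X
  · exact ⟨none, hΓ, Λ, ⟨Ψ, Q.red_mem hΔ h₁, Θ, hΘ, h₂⟩, Red.refl _⟩
  · refine ⟨some X, hΓ, _, ⟨Δ, hΔ, Θ, hΘ, Red.refl _⟩, .trans ?_ h₂⟩
    refine (red_seq_assoc_symm _ _ _).trans ?_
    rcases Θ with _ | Z
    · simpa using h₁
    · rcases Δ with _ | Y <;> rcases Ψ with _ | W <;>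
        first
          | exact h₁.elim
          | exact Derivation.seq h₁ (.id _ _)

theorem seq_assoc_symm : P.seq (Q.seq R) ≤ (P.seq Q).seq R := by
  rintro Λ ⟨Γ, hΓ, Ψ, ⟨Δ, hΔ, Θ, hΘ, h₁⟩, h₂⟩
  rcases Θ with _ | Z
  · exact ⟨Λ, ⟨Γ, hΓ, Ψ, Q.red_mem hΔ (by simpa using h₁), h₂⟩, none, hΘ, by simp [Red.refl]⟩
  · refine ⟨_, ⟨Γ, hΓ, Δ, hΔ, Red.refl _⟩, some Z, hΘ, .trans ?_ h₂⟩
    refine (red_seq_assoc _ _ _).trans ?_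
    rcases Γ with _ | X
    · exact h₁
    · rcases Δ with _ | Y <;> rcases Ψ with _ | W <;>
        first
          | exact h₁.elim
          | exact Derivation.seq (.id _ _) h₁

theorem exchange : (P.seq R).tens (Q.seq S) ≤ (P.tens Q).seq (R.tens S) := by
  rintro Λ ⟨_, ⟨Γ, hΓ, Δ, hΔ, h₁⟩, _, ⟨Γ', hΓ', Δ', hΔ', h₂⟩, h₃⟩
  exact ⟨_, ⟨Γ, hΓ, Γ', hΓ', Red.refl _⟩, _, ⟨Δ, hΔ, Δ', hΔ', Red.refl _⟩,
    (red_exchange _ _ _ _).trans ((h₁.tens h₂).trans h₃)⟩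

/-- Pad P to P ◁ 1, exchange, and absorb the unit into R. Only the lax law P ≤ P ◁ 1 is needed, not
its converse. -/
theorem tens_seq_le : P.tens (Q.seq R) ≤ (P.tens Q).seq R :=
  (tens_mono le_seq_unit le_rfl).trans (exchange.trans (seq_mono le_rfl unit_tens_le))

theorem tens_seq_le_right : P.tens (Q.seq R) ≤ Q.seq (P.tens R) :=
  (tens_mono le_unit_seq le_rfl).trans (exchange.trans (seq_mono unit_tens_le le_rfl))

theorem tens_le_seq : P.tens Q ≤ P.seq Q :=
  (tens_mono le_rfl le_unit_seq).trans
    (tens_seq_le.trans (seq_mono (tens_comm.trans unit_tens_le) le_rfl))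

theorem tens_imp_le : P.tens (Q.imp R) ≤ (P.imp Q).imp R := by
  rw [← tens_le_iff]
  refine tens_comm.trans (tens_assoc_symm.trans ?_)
  exact (tens_mono imp_tens_le le_rfl).trans (tens_comm.trans imp_tens_le)

theorem imp_tens_le_imp : (P.imp Q).tens R ≤ P.imp (Q.tens R) := by
  rw [← tens_le_iff]
  refine (tens_mono tens_comm le_rfl).trans (tens_assoc.trans ?_)
  exact (tens_mono le_rfl imp_tens_le).trans tens_comm

theorem imp_seq_le : (P.imp Q).seq R ≤ P.imp (Q.seq R) := by
  rw [← tens_le_iff]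
  exact tens_comm.trans (tens_seq_le.trans (seq_mono (tens_comm.trans imp_tens_le) le_rfl))

theorem seq_imp_le : Q.seq (P.imp R) ≤ P.imp (Q.seq R) := by
  rw [← tens_le_iff]
  exact tens_comm.trans (tens_seq_le_right.trans (seq_mono le_rfl (tens_comm.trans imp_tens_le)))

theorem imp_seq_imp_le : (P.imp Q).seq (R.imp S) ≤ (P.seq R).imp (Q.seq S) := by
  rw [← tens_le_iff]
  exact exchange.trans (seq_mono imp_tens_le imp_tens_le)

theorem le_unit_imp : P ≤ unit.imp P := tens_le_iff.1 (tens_comm.trans unit_tens_le)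

theorem unit_imp_le : unit.imp P ≤ P := le_unit_tens.trans (tens_comm.trans imp_tens_le)

theorem unit_le_imp_self : unit ≤ P.imp P := tens_le_iff.1 unit_tens_le

theorem curry : (P.tens Q).imp R ≤ P.imp (Q.imp R) :=
  tens_le_iff.1 (tens_le_iff.1 (tens_assoc.trans imp_tens_le))

theorem uncurry : P.imp (Q.imp R) ≤ (P.tens Q).imp R :=
  tens_le_iff.1 (tens_assoc_symm.trans ((tens_mono imp_tens_le le_rfl).trans imp_tens_le))

end Prp

/-! ### Soundness and cut-free completeness -/

/-- The interpretation of formulas in the phase model. -/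
def Formula.interp : Formula α → Prp α
  | .atom a => .provers (.atom a)
  | .unit => .unit
  | .tens A B => A.interp.tens B.interp
  | .imp A B => A.interp.imp B.interp
  | .seq A B => A.interp.seq B.interp

/-- The order between interpretations that corresponds to a polarity. -/
def Polarity.Le : Polarity → Prp α → Prp α → Prop
  | .pos, P, Q => P ≤ Q
  | .neg, P, Q => Q ≤ P

/-- Every rule instance is valid in the phase model. -/
theorem Rule.Inst.sound {r : Rule} {p : Polarity} {A B : Formula α} (h : r.Inst p A B) :
    p.Le A.interp B.interp := by
  cases h with
  | aiDownP => exact Prp.unit_le_imp_self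
  | uDownSeqLeftP => exact Prp.le_unit_seq
  | uDownSeqRightP => exact Prp.le_seq_unit
  | refP => exact Prp.tens_le_seq
  | refN => exact Prp.tens_le_seq
  | sLP => exact Prp.tens_imp_le
  | sRP => exact Prp.imp_tens_le_imp
  | sLN => exact Prp.tens_imp_le
  | sRN => exact Prp.imp_tens_le_imp
  | sqLP => exact Prp.imp_seq_le
  | sqRP => exact Prp.seq_imp_le
  | sqLN => exact Prp.tens_seq_le
  | sqRN => exact Prp.tens_seq_le_right
  | qDownP => exact Prp.imp_seq_imp_le
  | qDownN => exact Prp.exchange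
  | comTens => cases p <;> exact Prp.tens_comm
  | assoTens => cases p; exacts [Prp.tens_assoc, Prp.tens_assoc_symm]
  | assoSeqL => cases p; exacts [Prp.seq_assoc, Prp.seq_assoc_symm]
  | assoSeqR => cases p; exacts [Prp.seq_assoc_symm, Prp.seq_assoc]
  | uDownTens => cases p; exacts [Prp.le_unit_tens, Prp.unit_tens_le]
  | uDownImp => cases p; exacts [Prp.le_unit_imp, Prp.unit_imp_le]
  | cur => cases p; exacts [Prp.curry, Prp.uncurry]
  | ruc => cases p; exacts [Prp.uncurry, Prp.curry]
  -- The up-rules of fixed polarity need no new inequality: each reuses that of a down-rule of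
  -- opposite polarity.
  | aiUpN => exact Prp.unit_le_imp_self
  | uUpSeqLeftN => exact Prp.le_unit_seq
  | uUpSeqRightN => exact Prp.le_seq_unit
  | uUpTens => cases p; exacts [Prp.unit_tens_le, Prp.le_unit_tens]
  | uUpImp => cases p; exacts [Prp.unit_imp_le, Prp.le_unit_imp]
  | qUpP => exact Prp.exchange
  | qUpN => exact Prp.imp_seq_imp_le
  | iDownP => exact Prp.unit_le_imp_self
  | iUpN => exact Prp.unit_le_imp_self

/-- Derivations in any system of rules are valid in the phase model. -/
theorem Derivation.sound {X : Set Rule} {p : Polarity} {A B : Formula α}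
    (h : Derivation X p A B) : p.Le A.interp B.interp := by
  induction h with
  | id p => cases p <;> exact le_refl _
  | @tens p _ _ _ _ _ _ ih₁ ih₂ => cases p <;> exact Prp.tens_mono ih₁ ih₂
  | @seq p _ _ _ _ _ _ ih₁ ih₂ => cases p <;> exact Prp.seq_mono ih₁ ih₂
  | @imp p _ _ _ _ _ _ ih₁ ih₂ => cases p <;> exact Prp.imp_mono ih₁ ih₂
  | @comp p _ _ _ _ _ _ _ hi _ ih₁ ih₂ =>
    cases p
    · exact le_trans ih₁ (le_trans hi.sound ih₂)
    · exact le_trans ih₂ (le_trans hi.sound ih₁)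

/-- A formula forces its interpretation, and every context that forces it proves the formula. -/
theorem Formula.mem_interp_and_proves (A : Formula α) :
    some A ∈ A.interp ∧ ∀ Γ ∈ A.interp, Γ.Proves A := by
  induction A with
  | atom a => exact ⟨.of_inst (by simp [IBV]) (.aiDownP a), fun _ h => h⟩
  | unit =>
    exact ⟨NegDerivation.refl _, fun Γ h => Proves.red (Γ := none) (Derivation.id _ _) h⟩
  | tens A B ihA ihB =>
    exact ⟨⟨_, ihA.1, _, ihB.1, Red.refl _⟩,
      fun _ ⟨Γ, hΓ, Δ, hΔ, h⟩ => ((ihA.2 Γ hΓ).tens (ihB.2 Δ hΔ)).red h⟩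
  | seq A B ihA ihB =>
    exact ⟨⟨_, ihA.1, _, ihB.1, Red.refl _⟩,
      fun _ ⟨Γ, hΓ, Δ, hΔ, h⟩ => ((ihA.2 Γ hΓ).seq (ihB.2 Δ hΔ)).red h⟩
  | imp A B ihA ihB =>
    -- The two halves cross over at A: membership of A ⊸ B uses that contexts forcing A prove it,
    -- and provability uses that A forces itself.
    exact ⟨fun Γ hΓ => Prp.mem_of_red ihB.1 (ihA.2 Γ hΓ).red_tens_imp,
      fun Γ hΓ => Proves.curry (ihB.2 _ (hΓ _ ihA.1))⟩

/-- Whatever is provable with any of the rules is provable in `IBV`. -/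
theorem Provable.toIBV {X : Set Rule} {A : Formula α} (h : Provable X A) : Provable IBV A :=
  A.mem_interp_and_proves.2 none (Derivation.sound h Prp.none_mem_unit)

theorem Derivation.mono {X Y : Set Rule} (hXY : X ⊆ Y) {p : Polarity} {A B : Formula α}
    (h : Derivation X p A B) : Derivation Y p A B := by
  induction h with
  | id => exact .id _ _
  | tens _ _ ih₁ ih₂ => exact .tens ih₁ ih₂
  | seq _ _ ih₁ ih₂ => exact .seq ih₁ ih₂
  | imp _ _ ih₁ ih₂ => exact .imp ih₁ ih₂
  | comp _ hr hi _ ih₁ ih₂ => exact .comp ih₁ (hXY hr) hi ih₂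

theorem admissible_IBV (r : Rule) : Admissible α IBV r := fun _ h => h.toIBV

end IBVLogic

theorem mainTheorem1 (α : Type*) :
    -- every up-rule is admissible for `IBV`
    (IBVLogic.Admissible α IBVLogic.IBV .uUpSeqLeftN ∧
      IBVLogic.Admissible α IBVLogic.IBV .uUpSeqRightN ∧
      IBVLogic.Admissible α IBVLogic.IBV .uUpTens ∧
      IBVLogic.Admissible α IBVLogic.IBV .uUpImp ∧
      IBVLogic.Admissible α IBVLogic.IBV .aiUpN ∧
      IBVLogic.Admissible α IBVLogic.IBV .qUpP ∧
      IBVLogic.Admissible α IBVLogic.IBV .qUpN) ∧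
    -- `SIBV` and `IBV` prove the same formulas
    (∀ A : IBVLogic.Formula α,
      IBVLogic.Provable IBVLogic.SIBV A ↔ IBVLogic.Provable IBVLogic.IBV A) ∧
    -- the general cut rule is admissible for `IBV`
    IBVLogic.Admissible α IBVLogic.IBV .iUpN := by
  open IBVLogic in
  exact ⟨⟨admissible_IBV _, admissible_IBV _, admissible_IBV _, admissible_IBV _, admissible_IBV _,
    admissible_IBV _, admissible_IBV _⟩,
    fun _ => ⟨fun h => h.toIBV, fun h => Derivation.mono Set.subset_union_left h⟩,
    admissible_IBV _⟩
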